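/- Conventions. A $p$-ary code of length $N$ is a set $\mathcal C$ of functions $D\to\mathbb F_p$ on a set $D$ with $|D|=N$; $\delta(f,g)=|\{x\in D: f(x)\neq g(x)\}|/N$; $f$ is $\delta$-close to $g$ if $\delta(f,g)\le\delta$, and $\delta$-far from $g$ otherwise; $f$ is $\delta$-far from $\mathcal C$ if it is $\delta$-far from every $g\in\mathcal C$. The code $\mathcal C$ is a $(k,\delta)$-LCC if there is a probabilistic algorithm that, given $x\in D$ and oracle access to an $f:D\to\mathbb F_p$ which is $\delta$-close to some $g\in\mathcal C$, makes at most $k$ queries to $f$ and outputs $g(x)$ with probability at least $2/3$. It is a $(k,\eta,\delta)$-LTC if any two distinct codewords are $\delta$-far from each other and there is a probabilistic algorithm that, given oracle access to $f:D\to\mathbb F_p$, makes at most $k$ queries, accepts every $f\in\mathcal C$ with probability one, and, for every $\tau\ge 0$, rejects every $f$ that is $\tau$-far from $\mathcal C$ with probability at least $\eta\tau$. For a prime power $Q=p^\ell$ and $m\ge 1$, the $m$-dimensional lift of the parity-check code $\{f:\mathbb F_Q\to\mathbb F_p\mid\sum_{\alpha\in\mathbb F_Q}f(\alpha)=0\}$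 is the linear code of all $f:\mathbb F_Q^m\to\mathbb F_p$ whose restriction to every one-dimensional affine subspace $L$ of $\mathbb F_Q^m$ satisfies $\sum_{x\in L}f(x)=0$; its length is $Q^m$. Theorem. There is an absolute constant $c>0$ such that for every real $\varepsilon>0$ and every prime $p$ there is $\varepsilon'>0$ such that for infinitely many $N$ there is a linear $p$-ary code of length $N$ and dimension at least $N-N^{1-\varepsilon'}$ which is an $(N^{\varepsilon},\,N^{-\varepsilon}/3)$-LCC and an $(N^{\varepsilon},\,c\,N^{-2\varepsilon},\,N^{-\varepsilon})$-LTC. Moreover, this code can be taken to be the $m$-dimensional lift of the parity-check code $\{f:\mathbb F_Q\to\mathbb F_p\mid\sum_{\alpha}f(\alpha)=0\}$, where $m=\lceil 1/\varepsilon\rceil$, $Q=p^\ell$ for some $\ell\ge1$, and $N=Q^m$. -/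

import Mathlib

/-- A deterministic query algorithm with oracle access to a function `D → A` and outputs in `R`:
an adaptive decision tree, which either stops with an output, or queries the oracle at a point
of `D` and continues according to the answer. -/
inductive QueryAlg (D A R : Type*) where
  | output (r : R) : QueryAlg D A R
  | query (x : D) (next : A → QueryAlg D A R) : QueryAlg D A R

namespace QueryAlg

/-- The output of the algorithm on the oracle `f`. -/
def run {D A R : Type*} (f : D → A) : QueryAlg D A R → R
  | output r => r
  | query x next => run f (next (f x))

/-- The number of queries that the algorithm makes on the oracle `f`. -/
def numQueries {D A R : Type*} (f : D → A) : QueryAlg D A R → ℕ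
  | output _ => 0
  | query x next => numQueries f (next (f x)) + 1

end QueryAlg

/-- A probabilistic query algorithm: a probability distribution on deterministic ones. -/
abbrev ProbQueryAlg (D A R : Type*) := PMF (QueryAlg D A R)

namespace ProbQueryAlg

/-- The distribution of the output on the oracle `f`. -/
noncomputable def outputDist {D A R : Type*} (T : ProbQueryAlg D A R) (f : D → A) : PMF R :=
  PMF.map (QueryAlg.run f) T

/-- The algorithm makes at most `k` queries, whatever the oracle and the random choices are. -/
def MakesAtMost {D A R : Type*} (T : ProbQueryAlg D A R) (k : ℝ) : Prop :=
  ∀ t ∈ T.support, ∀ f : D → A, (t.numQueries f : ℝ) ≤ k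

end ProbQueryAlg

section Codes

variable {D F : Type*} [Fintype D] [DecidableEq F]

/-- The normalized Hamming distance `δ(f, g)`. -/
noncomputable def relDist (f g : D → F) : ℝ :=
  (hammingDist f g : ℝ) / (Fintype.card D : ℝ)

/-- `f` is `δ`-close to `g`. -/
def IsClose (δ : ℝ) (f g : D → F) : Prop := relDist f g ≤ δ

/-- `f` is `δ`-far from the code `C`: it is not `δ`-close to any codeword. -/
def IsFarFrom (δ : ℝ) (f : D → F) (C : Set (D → F)) : Prop := ∀ g ∈ C, ¬ IsClose δ f g

/-- `C` is a code of distance `δ`: distinct codewords are `δ`-far from each other. -/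
def HasDistance (C : Set (D → F)) (δ : ℝ) : Prop :=
  ∀ f ∈ C, ∀ g ∈ C, f ≠ g → ¬ IsClose δ f g

/-- `C` is a `(k, δ)`-locally correctable code. -/
def IsLCC (C : Set (D → F)) (k δ : ℝ) : Prop :=
  ∃ corr : D → ProbQueryAlg D F F,
    (∀ x, (corr x).MakesAtMost k) ∧
    ∀ (x : D) (f g : D → F), g ∈ C → IsClose δ f g →
      ENNReal.ofReal (2 / 3) ≤ (corr x).outputDist f (g x)

/-- `C` is a `(k, ε, δ)`-locally testable code; the output `true` means "accept", the output
`false` means "reject". -/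
def IsLTC (C : Set (D → F)) (k ε δ : ℝ) : Prop :=
  HasDistance C δ ∧
  ∃ test : ProbQueryAlg D F Bool,
    test.MakesAtMost k ∧
    (∀ f ∈ C, test.outputDist f true = 1) ∧
    ∀ (τ : ℝ) (f : D → F), 0 ≤ τ → IsFarFrom τ f C →
      ENNReal.ofReal (ε * τ) ≤ test.outputDist f false

end Codes

/-- The parity-check code over `F` with coordinate set `D`: all `f` with `∑ x, f x = 0`. -/
def parityCheckCode (D F : Type*) [Fintype D] [Field F] : Submodule F (D → F) where
  carrier := {f | ∑ x, f x = 0}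
  add_mem' := by
    intro f g hf hg
    simp only [Set.mem_ofPred_eq, Pi.add_apply, Finset.sum_add_distrib] at *
    rw [hf, hg, add_zero]
  zero_mem' := by simp
  smul_mem' := by
    intro a f hf
    simp only [Set.mem_ofPred_eq, Pi.smul_apply, smul_eq_mul, ← Finset.mul_sum] at *
    rw [hf, mul_zero]

/-- The `m`-dimensional lift (`t ≤ m`) of a linear code `C ⊆ {K^t → F}`: all `f : K^m → F` whose
restriction to every `t`-dimensional affine subspace of `K^m` lies in `C`. The subspace is
identified with `K^t` by an affine isomorphism, that is, it is the image of an injective affine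
map `φ : K^t → K^m`; all such identifications are required to give an element of `C` (for an
affine-invariant `C`, such as the parity-check code, it does not matter which one is taken). -/
def liftCode {K F : Type*} [Field K] [Field F] {t : ℕ} (m : ℕ)
    (C : Submodule F ((Fin t → K) → F)) : Submodule F ((Fin m → K) → F) where
  carrier := {f | ∀ φ : (Fin t → K) →ᵃ[K] (Fin m → K), Function.Injective φ →
    (fun u => f (φ u)) ∈ C}
  add_mem' := fun hf hg φ hφ => C.add_mem (hf φ hφ) (hg φ hφ)
  zero_mem' := fun _ _ => C.zero_mem
  smul_mem' := fun a _ hf φ hφ => C.smul_mem a (hf φ hφ)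

noncomputable instance galoisFieldFintype (p : ℕ) [Fact p.Prime] (l : ℕ) :
    Fintype (GaloisField p l) := Fintype.ofFinite _

/-- The lift to `m` dimensions of the parity-check code `{f : 𝔽_Q → 𝔽_p | ∑ f = 0}`, `Q = p ^ l`
(here `𝔽_Q` is regarded as the one-dimensional space `𝔽_Q^1`). -/
noncomputable def liftedParityCheck (p : ℕ) [Fact p.Prime] (l m : ℕ) :
    Submodule (ZMod p) ((Fin m → GaloisField p l) → ZMod p) :=
  liftCode m (parityCheckCode (Fin 1 → GaloisField p l) (ZMod p))

/-! Let `Q` be the field size. On a line through `x` the other `Q - 1` points determine the value at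
`x`, and in a random direction each of them is uniform on the space. A union bound then gives the
distance (`card_le_mul_card_support`) and the corrector (`card_lineVote_ne_le`). The tester checks a
random line. If few lines fail, the votes at each point mostly agree, and the winning votes form a
codeword near `f` (`exists_lineSum_eq_zero_of_badLines`), in the style of linearity testing.

For the dimension, write `Q = B ^ r` with `B` a power of `p` and `m ≤ B`. If the exponents of a
monomial all have digit `0` at one common place in base `B`, a Frobenius power moves that place to
the top, where the total degree is too small for a nonzero line sum
(`sum_prod_line_eq_zero_of_digit`). The other monomials number `(B ^ m - 1) ^ r`, a power of `N = (B
^ m) ^ r` with fixed exponent below `1`. Taking coordinates descends the bound from `𝔽_Q` to `𝔽_p`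
(`finrank_liftCode_le`). -/

namespace QueryAlg

/-- The algorithm that queries the points of a list in turn, adds up the answers, and outputs
a function of their sum. -/
def sumQueries {D F R : Type*} [Add F] (h : F → R) : List D → F → QueryAlg D F R
  | [], s => output (h s)
  | x :: xs, s => query x fun a => sumQueries h xs (s + a)

theorem run_sumQueries {D F R : Type*} [AddMonoid F] (h : F → R) (f : D → F) (xs : List D)
    (s : F) : (sumQueries h xs s).run f = h (s + (xs.map f).sum) := by
  induction xs generalizing s with
  | nil => simp [sumQueries, run]
  | cons x xs ih => simp [sumQueries, run, ih, add_assoc]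

theorem numQueries_sumQueries {D F R : Type*} [Add F] (h : F → R) (f : D → F) (xs : List D)
    (s : F) : (sumQueries h xs s).numQueries f = xs.length := by
  induction xs generalizing s with
  | nil => simp [sumQueries, numQueries]
  | cons x xs ih => simp [sumQueries, numQueries, ih]

end QueryAlg

/-! ### Counting outcomes and uniformly random queries -/

/-- The number of elements of a finite type that satisfy a predicate. -/
noncomputable def count {Ω : Type*} [Fintype Ω] (P : Ω → Prop) : ℕ :=
  (@Finset.filter Ω P (Classical.decPred P) Finset.univ).card

section Count

variable {Ω Ω' ι : Type*} [Fintype Ω] [Fintype Ω']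

theorem count_eq_card_filter (P : Ω → Prop) [DecidablePred P] :
    count P = (Finset.univ.filter P).card := by
  rw [count]
  congr!

theorem count_eq_sum (P : Ω → Prop) [DecidablePred P] : count P = ∑ ω, if P ω then 1 else 0 := by
  rw [count_eq_card_filter, Finset.card_filter]

theorem count_mono {P P' : Ω → Prop} (h : ∀ ω, P ω → P' ω) : count P ≤ count P' := by
  classical
  rw [count_eq_card_filter, count_eq_card_filter]
  exact Finset.card_le_card (Finset.monotone_filter_right _ fun ω _ => h ω)

theorem count_of_forall {P : Ω → Prop} (h : ∀ ω, P ω) : count P = Fintype.card Ω := by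
  classical
  rw [count_eq_card_filter, Finset.filter_true_of_mem fun ω _ => h ω, Finset.card_univ]

theorem count_add_count_not (P : Ω → Prop) :
    count P + count (fun ω => ¬ P ω) = Fintype.card Ω := by
  classical
  rw [count_eq_card_filter, count_eq_card_filter, Finset.card_filter_add_card_filter_not,
    Finset.card_univ]

theorem count_or_le (P P' : Ω → Prop) : count (fun ω => P ω ∨ P' ω) ≤ count P + count P' := by
  classical
  rw [count_eq_card_filter, count_eq_card_filter, count_eq_card_filter, Finset.filter_or]
  exact Finset.card_union_le _ _

theorem count_exists_le (s : Finset ι) (P : ι → Ω → Prop) :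
    count (fun ω => ∃ i ∈ s, P i ω) ≤ ∑ i ∈ s, count (P i) := by
  classical
  simp only [count_eq_card_filter]
  refine le_trans (Finset.card_le_card ?_) Finset.card_biUnion_le
  intro ω
  simp

theorem count_comp_equiv (e : Ω ≃ Ω') (P : Ω' → Prop) : count (fun ω => P (e ω)) = count P := by
  classical
  rw [count_eq_card_filter, count_eq_card_filter]
  exact Finset.card_equiv e (by simp)

theorem count_prod (P : Ω × Ω' → Prop) : count P = ∑ ω, count fun ω' => P (ω, ω') := by
  classical
  simp only [count_eq_sum, Fintype.sum_prod_type]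

theorem count_prod_right (P : Ω × Ω' → Prop) : count P = ∑ ω', count fun ω => P (ω, ω') := by
  classical
  simp only [count_eq_sum, Fintype.sum_prod_type_right]

end Count

namespace ProbQueryAlg

/-- The algorithm that chooses a list of points uniformly from a finite family and outputs
a function of the sum of the oracle's values there. -/
noncomputable def uniformSum {Ω D F R : Type*} [Fintype Ω] [Nonempty Ω] [AddMonoid F]
    (pts : Ω → List D) (h : F → R) : ProbQueryAlg D F R :=
  (PMF.uniformOfFintype Ω).map fun ω => QueryAlg.sumQueries h (pts ω) 0

theorem makesAtMost_uniformSum {Ω D F R : Type*} [Fintype Ω] [Nonempty Ω] [AddMonoid F]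
    (pts : Ω → List D) (h : F → R) {k : ℝ} (hk : ∀ ω, ((pts ω).length : ℝ) ≤ k) :
    (uniformSum pts h).MakesAtMost k := by
  intro t ht f
  obtain ⟨ω, -, rfl⟩ := (PMF.mem_support_map_iff _ _ _).1 ht
  rw [QueryAlg.numQueries_sumQueries]
  exact hk ω

theorem outputDist_uniformSum {Ω D F R : Type*} [Fintype Ω] [Nonempty Ω] [AddMonoid F]
    (pts : Ω → List D) (h : F → R) (f : D → F) (r : R) :
    (uniformSum pts h).outputDist f r =
      ENNReal.ofReal (count (fun ω => h ((pts ω).map f).sum = r) / (Fintype.card Ω : ℝ)) := by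
  classical
  have hpos : (0 : ℝ) < Fintype.card Ω := by exact_mod_cast Fintype.card_pos
  rw [outputDist, uniformSum, PMF.map_comp, PMF.map_apply, tsum_fintype,
    ENNReal.ofReal_div_of_pos hpos, ENNReal.ofReal_natCast, ENNReal.ofReal_natCast, count_eq_sum,
    ENNReal.div_eq_inv_mul, Nat.cast_sum, Finset.mul_sum]
  refine Finset.sum_congr rfl fun ω _ => ?_
  simp [QueryAlg.run_sumQueries, eq_comm]

end ProbQueryAlg

/-! ### Line sums, votes and self-correction -/

/-- For `t ≠ 0`, the affine permutation `b ↦ x + t • b`. -/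
def dilateEquiv {K V : Type*} [Field K] [AddCommGroup V] [Module K V] (x : V) {t : K}
    (ht : t ≠ 0) : V ≃ V :=
  (Equiv.smulRight ht).trans (Equiv.addLeft x)

theorem count_add_smul {K V : Type*} [Field K] [AddCommGroup V] [Module K V] [Fintype V]
    (x : V) {t : K} (ht : t ≠ 0) (P : V → Prop) : count (fun b => P (x + t • b)) = count P :=
  count_comp_equiv (dilateEquiv x ht) P

section Lines

open scoped Classical

variable {K F V : Type*} [Field K] [Fintype K] [AddCommGroup V] [Module K V]


/-- The sum of `f` over the (possibly degenerate) parametrized line `t ↦ a + t • b`. -/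
def lineSum [AddCommMonoid F] (f : V → F) (a b : V) : F := ∑ t : K, f (a + t • b)

/-- The value at `x` that the other points of the line `t ↦ x + t • b` predict. -/
noncomputable def lineVote (K : Type*) [Field K] [Fintype K] [Module K V] [AddCommGroup F]
    (f : V → F) (x b : V) : F :=
  -∑ t ∈ Finset.univ.erase (0 : K), f (x + t • b)

theorem lineSum_eq_sub_lineVote [AddCommGroup F] (f : V → F) (x b : V) :
    lineSum (K := K) f x b = f x - lineVote K f x b := by
  rw [lineSum, lineVote, sub_neg_eq_add, ← Finset.add_sum_erase _ _ (Finset.mem_univ (0 : K))]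
  simp

variable [Fintype V]

theorem card_erase_zero (K : Type*) [Field K] [Fintype K] :
    (Finset.univ.erase (0 : K)).card = Fintype.card K - 1 := by
  simp [Finset.card_univ]

/-- A nonzero function all of whose line sums vanish has many nonzero values. -/
theorem card_le_mul_card_support [AddCommGroup F] (h : V → F)
    (hh : ∀ a b : V, lineSum (K := K) h a b = 0) {x : V} (hx : h x ≠ 0) :
    Fintype.card V ≤ (Fintype.card K - 1) * count (fun y => h y ≠ 0) := by
  -- A line sum cannot vanish with `h x` as its only nonzero term.
  have key : ∀ b : V, ∃ t ∈ Finset.univ.erase (0 : K), h (x + t • b) ≠ 0 := by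
    intro b
    by_contra! hb
    have := hh x b
    rw [lineSum_eq_sub_lineVote, lineVote, Finset.sum_eq_zero hb] at this
    simp_all
  have := count_exists_le (Finset.univ.erase (0 : K)) (fun t b => h (x + t • b) ≠ 0)
  rw [count_of_forall key] at this
  refine this.trans_eq ?_
  rw [Finset.sum_congr rfl (g := fun _ => count (fun y => h y ≠ 0)),
    Finset.sum_const, card_erase_zero, smul_eq_mul]
  intro t ht
  exact count_add_smul x (Finset.ne_of_mem_erase ht) (fun y => h y ≠ 0)

/-- Few directions give a wrong prediction at `x` from a word close to a codeword. -/
theorem card_lineVote_ne_le [AddCommGroup F] (f g : V → F)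
    (hg : ∀ a b : V, lineSum (K := K) g a b = 0) (x : V) :
    count (fun b => lineVote K f x b ≠ g x) ≤
      (Fintype.card K - 1) * count (fun y => f y ≠ g y) := by
  have key : ∀ b : V, lineVote K f x b ≠ g x →
      ∃ t ∈ Finset.univ.erase (0 : K), f (x + t • b) ≠ g (x + t • b) := by
    intro b hb
    by_contra! hb'
    refine hb ?_
    have := hg x b
    rw [lineSum_eq_sub_lineVote, sub_eq_zero] at this
    rw [this, lineVote, lineVote, Finset.sum_congr rfl hb']
  have := count_exists_le (Finset.univ.erase (0 : K))
    (fun t b => f (x + t • b) ≠ g (x + t • b))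
  refine (count_mono key).trans
    (this.trans_eq ?_)
  rw [Finset.sum_congr rfl (g := fun _ => count (fun y => f y ≠ g y)),
    Finset.sum_const, card_erase_zero, smul_eq_mul]
  intro t ht
  exact count_add_smul x (Finset.ne_of_mem_erase ht) (fun y => f y ≠ g y)

/-- The number of parametrized lines on which the sum of `f` does not vanish. -/
noncomputable def badLines (K : Type*) [Field K] [Fintype K] [Module K V] [AddCommGroup F]
    (f : V → F) : ℕ :=
  count (fun ab : V × V => lineSum (K := K) f ab.1 ab.2 ≠ 0)

/-- If all lines of the grid `x + t • b₁ + s • b₂` (`s, t ≠ 0`) that extend to its two axes are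
good, both votes equal the sum of `f` over the grid, summed in either order. There are `2 (Q - 1)`
such lines, each a uniformly random one. -/
theorem card_lineVote_ne_lineVote_le [AddCommGroup F] (f : V → F) (x : V) :
    count (fun b : V × V => lineVote K f x b.1 ≠ lineVote K f x b.2) ≤
      2 * (Fintype.card K - 1) * badLines K f := by
  set T := Finset.univ.erase (0 : K) with hT
  let P : K → V × V → Prop := fun t b => lineSum (K := K) f (x + t • b.1) b.2 ≠ 0
  let P' : K → V × V → Prop := fun t b => lineSum (K := K) f (x + t • b.2) b.1 ≠ 0
  have key : ∀ b : V × V, lineVote K f x b.1 ≠ lineVote K f x b.2 →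
      (∃ t ∈ T, P t b) ∨ (∃ t ∈ T, P' t b) := by
    intro b hb
    by_contra! hb'
    refine hb ?_
    have h1 : ∀ t ∈ T, f (x + t • b.1) = -∑ s ∈ T, f (x + t • b.1 + s • b.2) := by
      intro t ht
      have := not_not.1 (hb'.1 t ht)
      rwa [lineSum_eq_sub_lineVote, sub_eq_zero] at this
    have h2 : ∀ s ∈ T, f (x + s • b.2) = -∑ t ∈ T, f (x + s • b.2 + t • b.1) := by
      intro t ht
      have := not_not.1 (hb'.2 t ht)
      rwa [lineSum_eq_sub_lineVote, sub_eq_zero] at this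
    rw [lineVote, lineVote, ← hT, Finset.sum_congr rfl h1, Finset.sum_congr rfl h2,
      Finset.sum_neg_distrib, Finset.sum_neg_distrib, Finset.sum_comm]
    simp only [add_right_comm]
  have hP : ∀ t ∈ T, count (P t) = badLines K f := fun t ht =>
    count_comp_equiv ((dilateEquiv x (Finset.ne_of_mem_erase ht)).prodCongr (Equiv.refl V))
      (fun ab => lineSum (K := K) f ab.1 ab.2 ≠ 0)
  have hP' : ∀ t ∈ T, count (P' t) = badLines K f := fun t ht =>
    count_comp_equiv ((Equiv.prodComm V V).trans
      ((dilateEquiv x (Finset.ne_of_mem_erase ht)).prodCongr (Equiv.refl V)))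
      (fun ab => lineSum (K := K) f ab.1 ab.2 ≠ 0)
  calc _ ≤ count (fun b => (∃ t ∈ T, P t b) ∨ (∃ t ∈ T, P' t b)) :=
        count_mono key
    _ ≤ count (fun b => ∃ t ∈ T, P t b) +
        count (fun b => ∃ t ∈ T, P' t b) := count_or_le _ _
    _ ≤ ∑ t ∈ T, count (P t) + ∑ t ∈ T, count (P' t) :=
        add_le_add (count_exists_le _ _) (count_exists_le _ _)
    _ = 2 * (Fintype.card K - 1) * badLines K f := by
        rw [Finset.sum_congr rfl hP, Finset.sum_congr rfl hP', Finset.sum_const, hT,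
          card_erase_zero, smul_eq_mul]
        ring

/-- Averaging: the vote of the direction with fewest disagreements does at least as well as the
mean. -/
theorem exists_card_lineVote_ne_le [AddCommGroup F] (f : V → F) (x : V) :
    ∃ c : F, Fintype.card V * count (fun b : V => lineVote K f x b ≠ c) ≤
      2 * (Fintype.card K - 1) * badLines K f := by
  obtain ⟨b, -, hb⟩ := Finset.exists_min_image (Finset.univ : Finset V)
    (fun b' => count (fun b : V => lineVote K f x b ≠ lineVote K f x b'))
    ⟨x, Finset.mem_univ x⟩
  refine ⟨lineVote K f x b, le_trans ?_ (card_lineVote_ne_lineVote_le f x)⟩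
  rw [← Finset.card_univ, ← smul_eq_mul]
  refine (Finset.card_nsmul_le_sum _ _ _ hb).trans_eq ?_
  rw [count_prod_right]

/-- A function with few bad lines is close to a function without bad lines. -/
theorem exists_lineSum_eq_zero_of_badLines [AddCommGroup F] (f : V → F)
    (hf : (Fintype.card K - 1) * (2 * Fintype.card K + 1) * badLines K f <
      Fintype.card V * Fintype.card V) :
    ∃ g : V → F, (∀ a b : V, lineSum (K := K) g a b = 0) ∧
      Fintype.card V * count (fun x => f x ≠ g x) ≤ 2 * badLines K f := by
  choose g hg using exists_card_lineVote_ne_le (K := K) f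
  have hQ : 2 ≤ Fintype.card K := Fintype.one_lt_card
  refine ⟨g, fun a b => ?_, ?_⟩
  · by_contra hab
    set T := Finset.univ.erase (0 : K) with hT
    -- Consider the array `(a + t • b) + s • (u + t • v)`. Fixed `t` gives a vote at `a + t • b`;
    -- fixed `s ≠ 0` gives a line. If no row or column is bad, exchanging the sums makes the line
    -- sum of `g` zero.
    let P : K → V × V → Prop := fun t uv =>
      lineVote K f (a + t • b) (uv.1 + t • uv.2) ≠ g (a + t • b)
    let P' : K → V × V → Prop := fun s uv =>
      lineSum (K := K) f (a + s • uv.1) (b + s • uv.2) ≠ 0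
    have key : ∀ uv : V × V, (∃ t ∈ Finset.univ, P t uv) ∨ (∃ s ∈ T, P' s uv) := by
      intro uv
      by_contra! h
      refine hab ?_
      rw [lineSum, Finset.sum_congr rfl (fun t ht => (not_not.1 (h.1 t ht)).symm)]
      simp only [lineVote, Finset.sum_neg_distrib, neg_eq_zero]
      rw [Finset.sum_comm]
      refine Finset.sum_eq_zero fun s hs => ?_
      rw [← not_not.1 (h.2 s hs), lineSum]
      refine Finset.sum_congr rfl fun t _ => congrArg f ?_
      rw [smul_add, smul_add, smul_comm s t]
      abel
    have hP : ∀ t, count (P t) ≤ 2 * (Fintype.card K - 1) * badLines K f := by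
      intro t
      refine le_trans (le_of_eq ?_) (hg (a + t • b))
      -- For fixed `v` the direction `u + t • v` is uniform.
      let e : V × V ≃ V × V := (Equiv.prodComm V V).trans
        ((Equiv.prodShear (Equiv.refl V) fun v => Equiv.addRight (t • v)))
      refine (count_comp_equiv e fun vw => lineVote K f (a + t • b) vw.2 ≠ g (a + t • b)).trans ?_
      simp only [count_prod, Finset.sum_const, Finset.card_univ, smul_eq_mul]
    have hP' : ∀ s ∈ T, count (P' s) = badLines K f := fun s hs =>
      count_comp_equiv ((dilateEquiv a (Finset.ne_of_mem_erase hs)).prodCongr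
        (dilateEquiv b (Finset.ne_of_mem_erase hs)))
        (fun ab => lineSum (K := K) f ab.1 ab.2 ≠ 0)
    -- The coefficients add up to `(Q - 1) (2 Q + 1)`, the constant in `hf`.
    have : Fintype.card V * Fintype.card V ≤
        Fintype.card K * (2 * (Fintype.card K - 1) * badLines K f) +
          (Fintype.card K - 1) * badLines K f := by
      calc _ = count (fun uv => (∃ t ∈ Finset.univ, P t uv) ∨ (∃ s ∈ T, P' s uv)) := by
            rw [count_of_forall key, Fintype.card_prod]
        _ ≤ count (fun uv => ∃ t ∈ Finset.univ, P t uv) +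
            count (fun uv => ∃ s ∈ T, P' s uv) := count_or_le _ _
        _ ≤ ∑ t, count (P t) + ∑ s ∈ T, count (P' s) :=
            add_le_add (count_exists_le _ _) (count_exists_le _ _)
        _ ≤ _ := by
            rw [Finset.sum_congr rfl hP', Finset.sum_const, hT, card_erase_zero, smul_eq_mul]
            gcongr
            exact (Finset.sum_le_card_nsmul _ _ _ fun t _ => hP t).trans_eq
              (by rw [Finset.card_univ, smul_eq_mul])
    nlinarith
  · have half : ∀ x, f x ≠ g x → Fintype.card V ≤
        2 * count (fun b => lineSum (K := K) f x b ≠ 0) := by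
      intro x hx
      set E := count (fun b : V => lineVote K f x b ≠ g x) with hE
      have h1 : Fintype.card V ≤
          count (fun b => lineSum (K := K) f x b ≠ 0) + E := by
        rw [← count_add_count_not (fun b : V => lineVote K f x b = g x), hE]
        refine Nat.add_le_add_right (count_mono fun b hb => ?_) _
        rw [lineSum_eq_sub_lineVote, hb]
        exact sub_ne_zero.2 hx
      -- Since `Q ≥ 2`, `4 (Q - 1) ≤ (Q - 1) (2 Q + 1)`, so `hf` suffices.
      have h2 : 2 * E ≤ Fintype.card V := by
        have h3 := hg x
        rw [← hE] at h3
        obtain ⟨k, hk⟩ := Nat.exists_eq_add_of_le hQ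
        have hV : 0 < Fintype.card V := Fintype.card_pos_iff.2 ⟨x⟩
        refine le_of_mul_le_mul_left ?_ hV
        rw [hk] at hf h3
        have : 2 + k - 1 = k + 1 := by omega
        rw [this] at hf h3
        nlinarith [Nat.zero_le ((k + 1) * badLines K f), Nat.zero_le ((k + 1) * k * badLines K f)]
      omega
    rw [mul_comm, ← smul_eq_mul, count_eq_card_filter]
    refine (Finset.card_nsmul_le_sum _ _ _ fun x hx => half x (Finset.mem_filter.1 hx).2).trans ?_
    rw [← Finset.mul_sum]
    refine Nat.mul_le_mul_left _ ?_
    refine (Finset.sum_le_sum_of_subset (Finset.filter_subset _ _)).trans_eq ?_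
    rw [badLines, count_prod]

end Lines

/-! ### Distance, correction and testing of the lifted code -/

theorem relDist_eq_count {D F : Type*} [Fintype D] [DecidableEq F] (f g : D → F) :
    relDist f g = (count fun x => f x ≠ g x) / (Fintype.card D : ℝ) := by
  rw [relDist, hammingDist, count_eq_card_filter]

theorem relDist_le_one {D F : Type*} [Fintype D] [DecidableEq F] (f g : D → F) :
    relDist f g ≤ 1 :=
  div_le_one_of_le₀ (by exact_mod_cast hammingDist_le_card_fintype) (by positivity)

section LiftedParityCheck

variable {K F : Type*} [Field K] [Fintype K] [Field F] {m : ℕ}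

/-- Degenerate lines `b = 0` impose nothing, as `Q = 0` in `F`; hence directions can be sampled from
the whole space. -/
theorem mem_liftCode_parityCheckCode_iff (hF : (Fintype.card K : F) = 0)
    (f : (Fin m → K) → F) :
    f ∈ liftCode m (parityCheckCode (Fin 1 → K) F) ↔ ∀ a b, lineSum (K := K) f a b = 0 := by
  constructor
  · intro hf a b
    by_cases hb : b = 0
    · simp [lineSum, hb, hF]
    let φ : (Fin 1 → K) →ᵃ[K] (Fin m → K) :=
      AffineMap.const K (Fin 1 → K) a +
        ((LinearMap.proj (R := K) (φ := fun _ : Fin 1 => K) 0).smulRight b).toAffineMap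
    have hφ : ∀ u, φ u = a + u 0 • b := fun u => rfl
    have hinj : Function.Injective φ := by
      intro u v huv
      rw [hφ, hφ, add_right_inj] at huv
      have := smul_left_injective K hb huv
      ext i
      rwa [Subsingleton.elim i 0]
    have h : ∑ u, f (φ u) = 0 := hf φ hinj
    rw [← h, lineSum]
    exact (Fintype.sum_equiv (Equiv.funUnique (Fin 1) K) _ _ fun u => by rw [hφ]; rfl).symm
  · intro hf φ _
    have hφ : ∀ u, φ u = φ 0 + u 0 • φ.linear (fun _ => 1) := by
      intro u
      have h1 := φ.map_vadd 0 u
      have h2 : u = u 0 • fun _ => (1 : K) := by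
        ext i
        simp [Subsingleton.elim i 0]
      rw [vadd_eq_add, add_zero, vadd_eq_add] at h1
      rw [h1, add_comm, ← map_smul, ← h2]
    change ∑ u, f (φ u) = 0
    rw [← hf (φ 0) (φ.linear fun _ => 1), lineSum]
    exact Fintype.sum_equiv (Equiv.funUnique (Fin 1) K) _ _ fun u => by rw [hφ]; rfl

variable [DecidableEq F]

theorem hasDistance_liftCode_parityCheckCode (hF : (Fintype.card K : F) = 0) {δ : ℝ}
    (hδ : δ ≤ 1 / Fintype.card K) :
    HasDistance (liftCode m (parityCheckCode (Fin 1 → K) F) : Set ((Fin m → K) → F)) δ := by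
  intro f hf g hg hfg hclose
  obtain ⟨x, hx⟩ := Function.ne_iff.1 hfg
  have h := card_le_mul_card_support (K := K) (f - g)
    ((mem_liftCode_parityCheckCode_iff hF _).1 (Submodule.sub_mem _ hf hg)) (x := x)
    (by simpa [sub_eq_zero] using hx)
  simp only [Pi.sub_apply, sub_ne_zero] at h
  have hn : (0 : ℝ) < Fintype.card (Fin m → K) := by exact_mod_cast Fintype.card_pos
  have hQ : (1 : ℝ) < Fintype.card K := by exact_mod_cast Fintype.one_lt_card
  rw [IsClose, relDist_eq_count] at hclose
  have h1 := hclose.trans hδ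
  rw [div_le_div_iff₀ hn (by linarith)] at h1
  have h2 : ((Fintype.card (Fin m → K) : ℕ) : ℝ) ≤
      (Fintype.card K - 1) * (count fun x => f x ≠ g x : ℕ) := by
    have : (1 : ℕ) ≤ Fintype.card K := Fintype.card_pos
    have := (Nat.cast_le (α := ℝ)).2 h
    push_cast [Nat.cast_sub ‹1 ≤ Fintype.card K›] at this
    exact this
  nlinarith

/-- The vote of a random direction is wrong with probability at most `(Q - 1) / (3 Q) < 1 / 3`. -/
theorem isLCC_liftCode_parityCheckCode (hF : (Fintype.card K : F) = 0) {k δ : ℝ}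
    (hk : Fintype.card K ≤ k) (hδ : δ ≤ 1 / Fintype.card K / 3) :
    IsLCC (liftCode m (parityCheckCode (Fin 1 → K) F) : Set ((Fin m → K) → F)) k δ := by
  classical
  refine ⟨fun x => ProbQueryAlg.uniformSum
    (fun b : Fin m → K => (Finset.univ.erase (0 : K)).toList.map fun t => x + t • b)
    (fun s => -s), fun x => ProbQueryAlg.makesAtMost_uniformSum _ _ fun b => ?_, ?_⟩
  · rw [List.length_map, Finset.length_toList]
    refine le_trans ?_ hk
    exact_mod_cast Finset.card_le_univ _
  · intro x f g hg hclose
    rw [ProbQueryAlg.outputDist_uniformSum]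
    apply ENNReal.ofReal_le_ofReal
    have hvote : ∀ b : Fin m → K, -(((Finset.univ.erase (0 : K)).toList.map
        fun t => x + t • b).map f).sum = lineVote K f x b := by
      intro b
      rw [List.map_map, Finset.sum_map_toList, lineVote]
      congr!
    simp only [hvote]
    have h := card_lineVote_ne_le (K := K) f g ((mem_liftCode_parityCheckCode_iff hF _).1 hg) x
    have htot := count_add_count_not fun b => lineVote K f x b = g x
    have hn : (0 : ℝ) < Fintype.card (Fin m → K) := by exact_mod_cast Fintype.card_pos
    have hQ : (1 : ℝ) < Fintype.card K := by exact_mod_cast Fintype.one_lt_card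
    rw [IsClose, relDist_eq_count] at hclose
    have h1 := hclose.trans hδ
    rw [div_div, div_le_div_iff₀ hn (by linarith)] at h1
    have h2 : ((count fun b => ¬ lineVote K f x b = g x : ℕ) : ℝ) ≤
        (Fintype.card K - 1) * (count fun x => f x ≠ g x : ℕ) := by
      have : (1 : ℕ) ≤ Fintype.card K := Fintype.card_pos
      have := (Nat.cast_le (α := ℝ)).2 h
      push_cast [Nat.cast_sub ‹1 ≤ Fintype.card K›] at this
      exact this
    have htot' := congrArg (Nat.cast (R := ℝ)) htot
    push_cast at htot'
    have h3 : (0 : ℝ) ≤ (count fun x => f x ≠ g x : ℕ) := by positivity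
    rw [div_le_div_iff₀ (by norm_num) hn]
    linarith

theorem isLTC_liftCode_parityCheckCode (hF : (Fintype.card K : F) = 0) {k η δ : ℝ}
    (hk : Fintype.card K ≤ k) (hη0 : 0 ≤ η) (hη : η ≤ 1 / (2 * (Fintype.card K : ℝ) ^ 2))
    (hδ : δ ≤ 1 / Fintype.card K) :
    IsLTC (liftCode m (parityCheckCode (Fin 1 → K) F) : Set ((Fin m → K) → F)) k η δ := by
  refine ⟨hasDistance_liftCode_parityCheckCode hF hδ, ProbQueryAlg.uniformSum
    (fun ab : (Fin m → K) × (Fin m → K) =>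
      (Finset.univ : Finset K).toList.map fun t => ab.1 + t • ab.2)
    (fun s => decide (s = 0)), ProbQueryAlg.makesAtMost_uniformSum _ _ fun b => ?_, ?_, ?_⟩
  · rw [List.length_map, Finset.length_toList]
    exact hk
  all_goals
    have hsum : ∀ (f : (Fin m → K) → F) (ab : (Fin m → K) × (Fin m → K)),
        (((Finset.univ : Finset K).toList.map fun t => ab.1 + t • ab.2).map f).sum =
          lineSum (K := K) f ab.1 ab.2 := by
      intro f ab
      rw [List.map_map, Finset.sum_map_toList, lineSum]
      rfl
    have hn : (0 : ℝ) < Fintype.card (Fin m → K) := by exact_mod_cast Fintype.card_pos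
  · intro f hf
    rw [ProbQueryAlg.outputDist_uniformSum, count_of_forall, div_self, ENNReal.ofReal_one]
    · rw [Fintype.card_prod]
      positivity
    · intro ab
      rw [hsum, (mem_liftCode_parityCheckCode_iff hF _).1 hf, decide_eq_true rfl]
  · intro τ f hτ hfar
    rw [ProbQueryAlg.outputDist_uniformSum]
    apply ENNReal.ofReal_le_ofReal
    simp only [hsum, decide_eq_false_iff_not]
    change _ ≤ (badLines K f : ℝ) / _
    rw [Fintype.card_prod, Nat.cast_mul]
    have hQ : (2 : ℝ) ≤ Fintype.card K := by exact_mod_cast Fintype.one_lt_card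
    -- With few bad lines, `f` is rejected with probability at least `τ / 2`. Otherwise the
    -- probability is at least `1 / ((Q - 1) (2 Q + 1)) ≥ 1 / (2 Q ^ 2)`, which suffices because `τ
    -- ≤ 1`.
    by_cases h : (Fintype.card K - 1) * (2 * Fintype.card K + 1) * badLines K f <
      Fintype.card (Fin m → K) * Fintype.card (Fin m → K)
    · obtain ⟨g, hg, hfg⟩ := exists_lineSum_eq_zero_of_badLines f h
      have h1 := hfar g ((mem_liftCode_parityCheckCode_iff hF _).2 hg)
      rw [IsClose, relDist_eq_count, not_le, lt_div_iff₀ hn] at h1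
      have h2 := (Nat.cast_le (α := ℝ)).2 hfg
      push_cast at h2
      have h3 : η ≤ 1 / 2 := by
        refine hη.trans ?_
        rw [div_le_div_iff₀ (by positivity) (by norm_num)]
        nlinarith
      rw [le_div_iff₀ (by positivity)]
      have h4 : η * τ ≤ 1 / 2 * τ := by gcongr
      nlinarith
    · have hτ1 : τ ≤ 1 :=
        (not_le.1 (hfar 0 (Submodule.zero_mem _))).le.trans (relDist_le_one f 0)
      have h2 := (Nat.cast_le (α := ℝ)).2 (not_lt.1 h)
      have : (1 : ℕ) ≤ Fintype.card K := Fintype.card_pos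
      push_cast [Nat.cast_sub this] at h2
      refine (mul_le_of_le_one_right hη0 hτ1).trans (hη.trans ?_)
      rw [div_le_div_iff₀ (by positivity) (by positivity)]
      nlinarith [Nat.cast_nonneg (α := ℝ) (badLines K f),
        mul_nonneg (Nat.cast_nonneg (α := ℝ) (badLines K f)) (by linarith : (0:ℝ) ≤ Fintype.card K)]

end LiftedParityCheck

/-! ### Monomials whose line sums vanish -/

section Monomials

variable {K : Type} [Field K] [Fintype K] {m : ℕ}

/-- On a line this is a polynomial in `t` of degree below `Q - 1`, and the power sums `∑ t ^ k`
vanish for all `k < Q - 1`. -/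
theorem sum_prod_line_eq_zero_of_lt (e : Fin m → ℕ) (he : ∑ i, e i < Fintype.card K - 1)
    (a b : Fin m → K) : ∑ t : K, ∏ i, (a i + t * b i) ^ e i = 0 := by
  let P : Polynomial K := ∏ i, (Polynomial.C (a i) + Polynomial.X * Polynomial.C (b i)) ^ e i
  have hP : P.natDegree ≤ ∑ i, e i := by
    refine (Polynomial.natDegree_prod_le _ _).trans (Finset.sum_le_sum fun i _ => ?_)
    refine Polynomial.natDegree_pow_le.trans (mul_le_of_le_one_right (Nat.zero_le _) ?_)
    compute_degree
  have heval : ∀ t, ∏ i, (a i + t * b i) ^ e i = P.eval t := by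
    intro t
    simp only [P, Polynomial.eval_prod, Polynomial.eval_pow, Polynomial.eval_add,
      Polynomial.eval_C, Polynomial.eval_mul, Polynomial.eval_X]
  simp only [heval, Polynomial.eval_eq_sum_range]
  rw [Finset.sum_comm]
  refine Finset.sum_eq_zero fun k hk => ?_
  rw [← Finset.mul_sum, FiniteField.sum_pow_lt_card_sub_one K, mul_zero]
  have := Finset.mem_range.1 hk
  omega

/-- A monomial whose exponents all have a zero at the same place in base `B` sums to zero on
every line. -/
theorem sum_prod_line_eq_zero_of_digit (p : ℕ) [Fact p.Prime] [CharP K p] {s r B : ℕ}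
    (hB : B = p ^ s) (hB2 : 2 ≤ B) (hmB : m ≤ B) (hQ : Fintype.card K = B ^ r) (d : Fin m → ℕ)
    (hd : ∀ i, d i < B ^ r) {j : ℕ} (hj : j < r) (hdj : ∀ i, d i / B ^ j % B = 0)
    (a b : Fin m → K) : ∑ t : K, ∏ i, (a i + t * b i) ^ d i = 0 := by
  obtain ⟨u, rfl⟩ : ∃ u, r = j + u + 1 := ⟨r - 1 - j, by omega⟩
  have hB0 : 0 < B := by omega
  -- The cyclic shift of the digits of `d i` by `u` places: the zero digit goes from place `j` to
  -- the top place `j + u`. As `x ^ Q = x`, it represents the `B ^ u`-th power.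
  let e : Fin m → ℕ := fun i => d i % B ^ j * B ^ u + d i / B ^ (j + 1)
  have hpow : ∀ (i : Fin m) (x : K), (x ^ d i) ^ B ^ u = x ^ e i := by
    intro i x
    have h1 : d i = d i % B ^ j + B ^ (j + 1) * (d i / B ^ (j + 1)) := by
      have h2 := Nat.mod_add_div (d i) (B ^ j)
      have h3 := Nat.mod_add_div (d i / B ^ j) B
      rw [hdj i, zero_add, Nat.div_div_eq_div_mul, ← pow_succ] at h3
      conv_lhs => rw [← h2, ← h3, ← mul_assoc, ← pow_succ]
    have h4 : d i * B ^ u = d i % B ^ j * B ^ u + B ^ (j + u + 1) * (d i / B ^ (j + 1)) := by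
      conv_lhs => rw [h1]
      ring
    rw [← pow_mul, h4, pow_add, pow_mul x (B ^ (j + u + 1)), ← hQ, FiniteField.pow_card, ← pow_add]
  have he : ∀ i, e i + 1 ≤ B ^ (j + u) := by
    intro i
    have h1 : d i % B ^ j < B ^ j := Nat.mod_lt _ (by positivity)
    have h2 : d i / B ^ (j + 1) < B ^ u := by
      apply Nat.div_lt_of_lt_mul
      rw [← pow_add]
      convert hd i using 2
      ring
    calc e i + 1 ≤ d i % B ^ j * B ^ u + B ^ u := by simp only [e]; omega
      _ = (d i % B ^ j + 1) * B ^ u := by ring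
      _ ≤ B ^ j * B ^ u := Nat.mul_le_mul_right _ h1
      _ = B ^ (j + u) := (pow_add _ _ _).symm
  -- The sum is at most `m (B ^ (r - 1) - 1) ≤ B ^ r - B`; strictness uses `B ≥ 2`.
  have hsum : ∑ i, e i < Fintype.card K - 1 := by
    have h1 : ∑ i, (e i + 1) ≤ m * B ^ (j + u) :=
      (Finset.sum_le_card_nsmul _ _ _ fun i _ => he i).trans_eq (by simp)
    rw [Finset.sum_add_distrib] at h1
    simp only [Finset.sum_const, Finset.card_univ, Fintype.card_fin, smul_eq_mul, mul_one] at h1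
    have h2 : 1 ≤ B ^ (j + u) := Nat.one_le_pow _ _ hB0
    obtain ⟨v, rfl⟩ := Nat.exists_eq_add_of_le hmB
    obtain ⟨w, hw⟩ := Nat.exists_eq_add_of_le h2
    rw [hQ, pow_succ, Nat.lt_sub_iff_add_lt]
    rw [hw] at h1 ⊢
    nlinarith [Nat.zero_le (v * w)]
  have hzero : (∑ t : K, ∏ i, (a i + t * b i) ^ d i) ^ B ^ u = 0 := by
    rw [hB, ← pow_mul, sum_pow_char_pow]
    rw [← sum_prod_line_eq_zero_of_lt e hsum a b]
    refine Finset.sum_congr rfl fun t _ => ?_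
    rw [← Finset.prod_pow, pow_mul, ← hB]
    exact Finset.prod_congr rfl fun i _ => hpow i _
  exact eq_zero_of_pow_eq_zero hzero

/-- A polynomial of degree below `Q` in each variable that vanishes everywhere on `K ^ m` is zero.
-/
theorem linearIndependent_monomials :
    LinearIndependent K
      (fun (d : Fin m → Fin (Fintype.card K)) (x : Fin m → K) => ∏ i, x i ^ (d i : ℕ)) := by
  classical
  rw [Fintype.linearIndependent_iff]
  intro c hc
  let ex : (Fin m → Fin (Fintype.card K)) → Fin m →₀ ℕ := fun d =>
    Finsupp.equivFunOnFinite.symm fun i => (d i : ℕ)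
  have hex : Function.Injective ex := by
    intro d d' h
    ext i
    exact DFunLike.congr_fun h i
  let P : MvPolynomial (Fin m) K := ∑ d, MvPolynomial.monomial (ex d) (c d)
  have hP : P = 0 := by
    apply MvPolynomial.eq_zero_of_eval_eq_zero (Fin m) K P
    · intro v
      have := congrFun hc v
      simp only [Finset.sum_apply, Pi.smul_apply, smul_eq_mul, Pi.zero_apply] at this
      rw [← this]
      simp only [P, map_sum, MvPolynomial.eval_monomial]
      refine Finset.sum_congr rfl fun d _ => ?_
      rw [Finsupp.prod_fintype _ _ (by simp)]
      rfl
    · refine Submodule.sum_mem _ fun d _ => ?_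
      rw [MvPolynomial.mem_restrictDegree]
      intro s hs i
      rw [Finset.mem_singleton.1 (MvPolynomial.support_monomial_subset hs)]
      have := (d i).2
      simp only [ex, Finsupp.equivFunOnFinite_symm_apply_apply]
      omega
  intro d
  have := congrArg (MvPolynomial.coeff (ex d)) hP
  simpa [P, MvPolynomial.coeff_sum, MvPolynomial.coeff_monomial, hex.eq_iff] using this

end Monomials

/-! ### Dimension of the lifted code -/

theorem card_exists_row_eq_zero {X : Type*} [Fintype X] (z : X) (r : ℕ) :
    (count fun D : Fin r → X => ∃ j, D j = z) + (Fintype.card X - 1) ^ r =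
      Fintype.card X ^ r := by
  classical
  have h := count_add_count_not fun D : Fin r → X => ∃ j, D j = z
  simp only [not_exists] at h
  rw [Fintype.card_fun, Fintype.card_fin] at h
  rw [← h, count_eq_card_filter (fun D : Fin r → X => ∀ j, ¬ D j = z), ← Fintype.card_subtype,
    Fintype.card_congr (Equiv.subtypePiEquivPi (p := fun (_ : Fin r) x => ¬ x = z)),
    Fintype.card_fun, Fintype.card_fin]
  congr 2
  exact (Set.card_ne_eq z).symm

theorem card_le_finrank_of_linearIndependent {K V ι : Type*} [Field K] [AddCommGroup V]
    [Module K V] [FiniteDimensional K V] [Fintype ι] (W : Submodule K V) {v : ι → V}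
    (hv : LinearIndependent K v) (hmem : ∀ i, v i ∈ W) : Fintype.card ι ≤ Module.finrank K W :=
  (LinearIndependent.of_comp (v := fun i => (⟨v i, hmem i⟩ : W)) W.subtype
    hv).fintype_card_le_finrank

section Dimension

variable {K : Type} [Field K] [Fintype K] {m : ℕ}

/-- An exponent vector is an `r × m` array of base-`B` digits; an array with a zero row gives a
codeword. -/
theorem card_le_finrank_liftCode (p : ℕ) [Fact p.Prime] [CharP K p] {s r B : ℕ}
    (hB : B = p ^ s) (hB2 : 2 ≤ B) (hmB : m ≤ B) (hQ : Fintype.card K = B ^ r) :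
    (B ^ m) ^ r ≤ Module.finrank K (liftCode m (parityCheckCode (Fin 1 → K) K)) +
      (B ^ m - 1) ^ r := by
  classical
  have : NeZero B := ⟨by omega⟩
  have hcount := card_exists_row_eq_zero (0 : Fin m → Fin B) r
  rw [Fintype.card_fun, Fintype.card_fin, Fintype.card_fin] at hcount
  rw [← hcount]
  gcongr
  rw [count_eq_card_filter, ← Fintype.card_subtype]
  obtain ⟨ex, hex, hdig⟩ : ∃ ex : (Fin r → Fin m → Fin B) → Fin m → Fin (Fintype.card K),
      Function.Injective ex ∧
        ∀ D i (j : Fin r), (ex D i : ℕ) / B ^ (j : ℕ) % B = (D j i : ℕ) := by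
    refine ⟨fun D i => Fin.cast hQ.symm (finFunctionFinEquiv fun j => D j i), ?_, ?_⟩
    · intro D D' h
      ext j i
      have h1 := Fin.cast_injective _ (congrFun h i)
      exact congrArg Fin.val (congrFun (finFunctionFinEquiv.injective h1) j)
    · intro D i j
      have h1 := congrFun (finFunctionFinEquiv.symm_apply_apply fun j => D j i) j
      exact congrArg Fin.val h1
  refine card_le_finrank_of_linearIndependent _ (linearIndependent_monomials.comp
    (fun D : {D : Fin r → Fin m → Fin B // ∃ j, D j = 0} => ex D.1)
    (hex.comp Subtype.val_injective)) ?_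
  rintro ⟨D, j, hj⟩
  rw [mem_liftCode_parityCheckCode_iff (FiniteField.cast_card_eq_zero K)]
  intro a b
  refine sum_prod_line_eq_zero_of_digit p hB hB2 hmB hQ (fun i => ex D i) (fun i => ?_) j.2
    (fun i => ?_) a b
  · rw [← hQ]
    exact (ex D i).2
  · rw [hdig, hj]
    rfl

/-- Extending the scalars does not increase the dimension of a lifted parity-check code. -/
theorem finrank_liftCode_le {F : Type*} [Field F] [Fintype F] [Algebra F K]
    (hF : (Fintype.card K : F) = 0) :
    Module.finrank K (liftCode m (parityCheckCode (Fin 1 → K) K)) ≤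
      Module.finrank F (liftCode m (parityCheckCode (Fin 1 → K) F)) := by
  -- The coordinates of a codeword over `K` are `[K : F]` codewords over `F`. Comparing
  -- `F`-dimensions, the factor `[K : F]` cancels.
  let b := Module.finBasis F K
  let Φ : liftCode m (parityCheckCode (Fin 1 → K) K) →ₗ[F]
      (Fin (Module.finrank F K) → liftCode m (parityCheckCode (Fin 1 → K) F)) :=
    { toFun := fun f k => ⟨fun x => b.coord k (f.1 x), by
        rw [mem_liftCode_parityCheckCode_iff hF]
        intro u v
        have := (mem_liftCode_parityCheckCode_iff (FiniteField.cast_card_eq_zero K) _).1 f.2 u v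
        rw [lineSum] at this
        rw [lineSum, ← map_sum, this, map_zero]⟩
      map_add' := fun f g => by
        ext k x
        simp
      map_smul' := fun c f => by
        ext k x
        simp }
  have hΦ : Function.Injective Φ := by
    intro f g h
    ext x
    apply b.ext_elem
    intro k
    exact congrFun (congrArg Subtype.val (congrFun h k)) x
  have h1 := LinearMap.finrank_le_finrank_of_injective hΦ
  rw [Module.finrank_pi_fintype, Finset.sum_const, Finset.card_univ, Fintype.card_fin, smul_eq_mul,
    ← Module.finrank_mul_finrank F K] at h1
  exact Nat.le_of_mul_le_mul_left h1 Module.finrank_pos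

end Dimension

/-! ### Choice of parameters -/

theorem theorem2 :
    ∃ c : ℝ, 0 < c ∧
      ∀ (ε : ℝ), 0 < ε → ∀ (p : ℕ) [Fact p.Prime],
        ∃ ε' : ℝ, 0 < ε' ∧
          {N : ℕ | ∃ l m : ℕ, 1 ≤ l ∧ m = ⌈1 / ε⌉₊ ∧
            Fintype.card (Fin m → GaloisField p l) = N ∧
            (N : ℝ) - (N : ℝ) ^ (1 - ε') ≤
              (Module.finrank (ZMod p) (liftedParityCheck p l m) : ℝ) ∧
            IsLCC (liftedParityCheck p l m : Set ((Fin m → GaloisField p l) → ZMod p))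
              ((N : ℝ) ^ ε) ((N : ℝ) ^ (-ε) / 3) ∧
            IsLTC (liftedParityCheck p l m : Set ((Fin m → GaloisField p l) → ZMod p))
              ((N : ℝ) ^ ε) (c * (N : ℝ) ^ (-2 * ε)) ((N : ℝ) ^ (-ε))}.Infinite := by
  refine ⟨1 / 2, by norm_num, fun ε hε p _ => ?_⟩
  have hp2 : 2 ≤ p := (Fact.out : p.Prime).two_le
  obtain ⟨m, hm⟩ : ∃ m, m = ⌈1 / ε⌉₊ := ⟨_, rfl⟩
  have hm0 : m ≠ 0 := by
    rw [hm]
    exact (Nat.ceil_pos.2 (by positivity)).ne'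
  have hmε : 1 ≤ m * ε := by
    rw [← div_le_iff₀ hε, hm]
    exact Nat.le_ceil _
  have hmB : m ≤ p ^ m := (Nat.lt_pow_self hp2).le
  have hB2 : 2 ≤ p ^ m := hp2.trans (Nat.le_self_pow hm0 p)
  obtain ⟨X, hX⟩ : ∃ X, X = (p ^ m) ^ m := ⟨_, rfl⟩
  have hX2 : 2 ≤ X := hX ▸ hB2.trans (Nat.le_self_pow hm0 _)
  have hX2' : (2 : ℝ) ≤ X := by exact_mod_cast hX2
  -- With `B = p ^ m`, `Q = B ^ (r + 1)` and `X = B ^ m`, the length is `N = X ^ (r + 1)` and the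
  -- codimension is at most `(X - 1) ^ (r + 1) = N ^ (logb X (X - 1))`. The base `X` does not depend
  -- on `r`.
  refine ⟨1 - Real.logb X (X - 1), ?_, ?_⟩
  · rw [sub_pos, Real.logb_lt_iff_lt_rpow (by linarith) (by linarith), Real.rpow_one]
    linarith
  refine Set.infinite_of_injective_forall_mem (f := fun r : ℕ => X ^ (r + 1)) ?_ fun r => ?_
  · intro r r' h
    exact Nat.succ_injective (Nat.pow_right_injective hX2 h)
  · have hl : m * (r + 1) ≠ 0 := by positivity
    have hQ : Fintype.card (GaloisField p (m * (r + 1))) = (p ^ m) ^ (r + 1) := by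
      rw [Fintype.card_eq_nat_card, GaloisField.card p _ hl, pow_mul]
    have hN : Fintype.card (Fin m → GaloisField p (m * (r + 1))) = X ^ (r + 1) := by
      rw [Fintype.card_fun, Fintype.card_fin, hQ, hX, pow_right_comm]
    have hF : (Fintype.card (GaloisField p (m * (r + 1))) : ZMod p) = 0 := by
      rw [hQ, ← pow_mul, Nat.cast_pow, ZMod.natCast_self, zero_pow hl]
    obtain ⟨Q, hQQ⟩ : ∃ Q, Q = Fintype.card (GaloisField p (m * (r + 1))) := ⟨_, rfl⟩
    have hQ1 : (1 : ℝ) < Q := by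
      rw [hQQ]
      exact_mod_cast Fintype.one_lt_card
    have hNQ : ((X ^ (r + 1) : ℕ) : ℝ) = (Q : ℝ) ^ (m : ℝ) := by
      rw [← hN, Fintype.card_fun, Fintype.card_fin, Real.rpow_natCast, hQQ, Nat.cast_pow]
    -- `N ^ ε = Q ^ (m ε)` with `m ε ≥ 1`; every bound in `Q` becomes one in `N` through this.
    have hle : (Q : ℝ) ≤ ((X ^ (r + 1) : ℕ) : ℝ) ^ ε := by
      rw [hNQ, ← Real.rpow_mul (by positivity)]
      exact Real.self_le_rpow_of_one_le hQ1.le hmε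
    have hinv : ((X ^ (r + 1) : ℕ) : ℝ) ^ (-ε) ≤ 1 / Q := by
      rw [Real.rpow_neg (by positivity), one_div]
      exact inv_anti₀ (by linarith) hle
    have hinv2 : ((X ^ (r + 1) : ℕ) : ℝ) ^ (-2 * ε) ≤ (1 / Q) ^ 2 := by
      rw [show -2 * ε = -ε * (2 : ℕ) by push_cast; ring, Real.rpow_mul_natCast (by positivity)]
      gcongr
    refine ⟨m * (r + 1), m, Nat.pos_of_ne_zero hl, hm, hN, ?_, ?_, ?_⟩
    · have h1 := (card_le_finrank_liftCode (K := GaloisField p (m * (r + 1))) (m := m) p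
        rfl hB2 hmB hQ).trans (Nat.add_le_add_right (finrank_liftCode_le hF) _)
      rw [← hX] at h1
      have h2 := (Nat.cast_le (α := ℝ)).2 h1
      have h3 : ((X ^ (r + 1) : ℕ) : ℝ) ^ (1 - (1 - Real.logb X (X - 1))) =
          ((X : ℝ) - 1) ^ (r + 1) := by
        rw [sub_sub_cancel, Nat.cast_pow, ← Real.rpow_natCast, ← Real.rpow_natCast,
          ← Real.rpow_mul (by positivity), mul_comm, Real.rpow_mul (by positivity),
          Real.rpow_logb (by linarith) (by linarith) (by linarith)]
      rw [h3, sub_le_iff_le_add]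
      push_cast [Nat.cast_sub (by omega : 1 ≤ X)] at h2 ⊢
      exact h2
    · refine isLCC_liftCode_parityCheckCode hF ?_ ?_
      · rwa [← hQQ]
      · rw [← hQQ]
        gcongr
    · refine isLTC_liftCode_parityCheckCode hF ?_ (by positivity) ?_ ?_
      · rwa [← hQQ]
      · rw [← hQQ]
        refine (mul_le_mul_of_nonneg_left hinv2 (by norm_num)).trans_eq ?_
        field_simp
      · rwa [← hQQ]
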